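/- There is a numerical constant $c>0$ such that the following holds for all $d\ge 1$, $r\ge 0$, $S\ge 0$, $\sigma\ge 0$ and $T\in\mathbb{N}$. Consider the linear-Gaussian bandit with action set $\mathcal{A}=\{a\in\mathbb{R}^d : \|a\|_2\le r\}$: an unknown vector $\theta_*\sim\mathcal{N}(0,\Sigma_0)$ with $\Sigma_0=S^2 I_d$ is drawn, and at each time $t=0,1,2,\dots$ a player takes an action $A_t\in\mathcal{A}$ and receives the reward $$R_{t+1}=\theta_*^\top A_t+W_{t+1},$$ where the noise variables $W_{t+1}\sim\mathcal{N}(0,\sigma^2)$ are i.i.d. and $W_{t+1}$ is independent of $(\theta_*,A_0,R_1,\dots,A_{t-1},R_t,A_t)$. A policy $\pi$ maps each history $H_t=(A_0,R_1,\dots,A_{t-1},R_t)$ to a probability distribution $\pi(H_t)$ on $\mathcal{A}$ (measurably in $H_t$); given $(\theta_*,H_t)$, the action $A_t$ is drawn from $\pi(H_t)$. Let $A_*$ be an action maximizing $a\mapsto\theta_*^\top a$ over $\mathcal{A}$, and let $$\mathrm{Reg}^\pi(T)=\sum_{t=0}^{T-1}\mathbb{E}\left[\theta_*^\top A_*-R_{t+1}\right]$$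 be the Bayesian regret, where the expectation is over the prior, the noise and the randomness of the policy. Then for every policy $\pi$ all these expectations are of integrable random variables, and $$\mathrm{Reg}^\pi(T)\ \ge\ c\cdot S\, r\, d^{-1/2}\min\{T,d\}^2 .$$ -/

import Mathlib

open MeasureTheory ProbabilityTheory
open scoped NNReal RealInnerProductSpace

namespace LinGaussBandit

/-- A history `(A₀, R₁, …, A_{t-1}, R_t)`: entry `i` is the pair `(A_i, R_{i+1})` of the action
taken at time `i` and the reward received for it. Actions lie in the action set `𝒜`. -/
abbrev History {d : ℕ} (𝒜 : Set (EuclideanSpace ℝ (Fin d))) (t : ℕ) : Type :=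
  Fin t → 𝒜 × ℝ

/-- A (randomized) policy: at each time `t`, a measurable map from histories to probability
distributions over actions. -/
structure Policy {d : ℕ} (𝒜 : Set (EuclideanSpace ℝ (Fin d))) where
  /-- the distribution of `A_t` given the history up to time `t` -/
  action : (t : ℕ) → Kernel (History 𝒜 t) 𝒜
  /-- it is a probability distribution -/
  isMarkov : ∀ t, IsMarkovKernel (action t)

attribute [instance] Policy.isMarkov

/-- `a` maximizes `θᵀ a` over the action set `𝒜`. -/
def IsOptimalAction {d : ℕ} (𝒜 : Set (EuclideanSpace ℝ (Fin d)))
    (θ a : EuclideanSpace ℝ (Fin d)) : Prop :=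
  a ∈ 𝒜 ∧ ∀ b ∈ 𝒜, ⟪θ, b⟫ ≤ ⟪θ, a⟫

/-- One round. From `(((θ, H_t), A_t), W_{t+1})` form `(θ, H_{t+1})`, where the reward
`R_{t+1} = θᵀ A_t + W_{t+1}` is appended to the history together with `A_t`. -/
noncomputable def extend {d : ℕ} {𝒜 : Set (EuclideanSpace ℝ (Fin d))} {t : ℕ}
    (x : ((EuclideanSpace ℝ (Fin d) × History 𝒜 t) × 𝒜) × ℝ) :
    EuclideanSpace ℝ (Fin d) × History 𝒜 (t + 1) :=
  (x.1.1.1,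
    Fin.snoc (α := fun _ => 𝒜 × ℝ) x.1.1.2
      (x.1.2, ⟪x.1.1.1, (x.1.2 : EuclideanSpace ℝ (Fin d))⟫ + x.2))

theorem measurable_extend {d : ℕ} {𝒜 : Set (EuclideanSpace ℝ (Fin d))} {t : ℕ} :
    Measurable (extend (𝒜 := 𝒜) (t := t)) := by
  unfold extend
  refine Measurable.prodMk (by fun_prop) (measurable_pi_lambda _ fun i => ?_)
  refine Fin.lastCases ?_ (fun j => ?_) i
  · simp only [Fin.snoc_last]
    fun_prop
  · simp only [Fin.snoc_castSucc]
    fun_prop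

/-- The joint law of `(θ, H_t)` when policy `π` plays the linear-Gaussian bandit with prior
`θ ∼ N(0, Σ₀)` and noise `W_{t+1} ∼ N(0, σ²)`: given `(θ, H_t)`, the action `A_t` is drawn from
`π` at `H_t`, and the noise `W_{t+1}` is independent of `(θ, H_t, A_t)`. -/
noncomputable def law {d : ℕ} {𝒜 : Set (EuclideanSpace ℝ (Fin d))}
    (Sigma0 : Matrix (Fin d) (Fin d) ℝ) (σ : ℝ≥0) (π : Policy 𝒜) :
    (t : ℕ) → Measure (EuclideanSpace ℝ (Fin d) × History 𝒜 t)
  | 0 => (multivariateGaussian 0 Sigma0).prod (Measure.dirac Fin.elim0)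
  | t + 1 =>
      ((law Sigma0 σ π t ⊗ₘ (π.action t).comap Prod.snd measurable_snd).prod
        (gaussianReal 0 (σ ^ 2))).map extend

instance isProbabilityMeasure_law {d : ℕ} {𝒜 : Set (EuclideanSpace ℝ (Fin d))}
    (Sigma0 : Matrix (Fin d) (Fin d) ℝ) (σ : ℝ≥0) (π : Policy 𝒜) (t : ℕ) :
    IsProbabilityMeasure (law Sigma0 σ π t) := by
  induction t with
  | zero => unfold law; infer_instance
  | succ t ih =>
    unfold law
    exact Measure.isProbabilityMeasure_map measurable_extend.aemeasurable

/-- The regret `θᵀ A⋆ - R_{t+1}` of the round played at time `t`, as a function of `(θ, H_{t+1})`,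
where `A⋆ = aStar θ`. -/
noncomputable def instantRegret {d : ℕ} {𝒜 : Set (EuclideanSpace ℝ (Fin d))}
    (aStar : EuclideanSpace ℝ (Fin d) → EuclideanSpace ℝ (Fin d)) (t : ℕ)
    (x : EuclideanSpace ℝ (Fin d) × History 𝒜 (t + 1)) : ℝ :=
  ⟪x.1, aStar x.1⟫ - (x.2 (Fin.last t)).2

/-- The Bayesian regret `∑_{t < T} E[θᵀ A⋆ - R_{t+1}]` of the policy `π`. -/
noncomputable def bayesRegret {d : ℕ} {𝒜 : Set (EuclideanSpace ℝ (Fin d))}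
    (Sigma0 : Matrix (Fin d) (Fin d) ℝ) (σ : ℝ≥0)
    (aStar : EuclideanSpace ℝ (Fin d) → EuclideanSpace ℝ (Fin d)) (π : Policy 𝒜) (T : ℕ) : ℝ :=
  ∑ t ∈ Finset.range T, ∫ x, instantRegret aStar t x ∂(law Sigma0 σ π (t + 1))

end LinGaussBandit

/-! After `t` rounds the rewards have involved `θ` only through its projection onto the span of the
played actions, of dimension at most `t`. Hence `(θ, H_t)` has the law of `(x + Qξ, H_t)`, where `ξ`
is a copy of the prior independent of `(x, H_t)` and `Q` projects orthogonally to that span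
(`law_eq_map_latent`). This replaces any posterior computation and holds for every noise level.

Since `Qξ` has mean zero given `(x, H_t)`, Pythagoras gives `E‖x‖² = S²d - E‖Qξ‖² ≤ S²t`
(`integral_norm_sq_latent_le`). The policy sees only `H_t`, so `E⟪θ, A_t⟫ = E⟪x, A_t⟫ ≤ r E‖x‖ ≤ r S
√t` (`integral_inner_action_le`). The optimal action earns `r E‖θ‖ ≥ r S m √d`, with `m` the first
absolute Gaussian moment (`le_integral_norm_prior`).

A round thus costs at least `r S (m√d - √t)`, which is of order `r S √d` while `t` is below a small
multiple of `d`; later rounds cost at least `0`. Summing gives order `S r √d min(T, d)`, at least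
the claimed rate. -/

namespace LinGaussBandit

/-! ### Measurable dependence of an orthogonal projection on the spanning vectors -/

section Projection

variable {E : Type*} [NormedAddCommGroup E] [InnerProductSpace ℝ E] [FiniteDimensional ℝ E]

/-- An explicit formula from which measurability in `f` can be read off. Dependent families are
allowed: a vanishing Gram–Schmidt vector contributes zero. -/
theorem starProjection_span_eq_sum_gramSchmidt {t : ℕ} (f : Fin t → E) (x : E) :
    (Submodule.span ℝ (Set.range f)).starProjection x =
      ∑ i, (⟪InnerProductSpace.gramSchmidt ℝ f i, x⟫ /
        ‖InnerProductSpace.gramSchmidt ℝ f i‖ ^ 2) • InnerProductSpace.gramSchmidt ℝ f i := by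
  set g := InnerProductSpace.gramSchmidt ℝ f with hg
  rw [← InnerProductSpace.span_gramSchmidt ℝ f, ← hg]
  refine Submodule.eq_starProjection_of_mem_orthogonal
    (Submodule.sum_mem (Submodule.span ℝ (Set.range g)) fun i _ =>
      Submodule.smul_mem _ _ (Submodule.subset_span (Set.mem_range_self i))) ?_
  rw [Submodule.mem_orthogonal]
  intro u hu
  induction hu using Submodule.span_induction with
  | mem u hu =>
    obtain ⟨j, rfl⟩ := hu
    rw [inner_sub_right, inner_sum, Finset.sum_eq_single j]
    · rw [real_inner_smul_right, real_inner_self_eq_norm_sq]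
      by_cases h : g j = 0
      · simp [h]
      · have : ‖g j‖ ≠ 0 := by simpa using h
        field_simp
        ring
    · intro i _ hij
      rw [real_inner_smul_right, hg, InnerProductSpace.gramSchmidt_orthogonal ℝ f hij.symm,
        mul_zero]
    · simp
  | zero => simp
  | add u v _ _ hu hv => rw [inner_add_left, hu, hv, add_zero]
  | smul c u _ hu => rw [real_inner_smul_left, hu, mul_zero]

variable [MeasurableSpace E] [BorelSpace E]

theorem measurable_gramSchmidt {t : ℕ} (i : Fin t) :
    Measurable fun f : Fin t → E => InnerProductSpace.gramSchmidt ℝ f i := by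
  induction i using WellFoundedLT.induction with
  | ind i ih =>
    have heq : (fun f : Fin t → E => InnerProductSpace.gramSchmidt ℝ f i) = fun f =>
        f i - ∑ j ∈ Finset.Iio i, (⟪InnerProductSpace.gramSchmidt ℝ f j, f i⟫ /
          ‖InnerProductSpace.gramSchmidt ℝ f j‖ ^ 2) • InnerProductSpace.gramSchmidt ℝ f j := by
      funext f
      rw [InnerProductSpace.gramSchmidt_def]
      simp_rw [Submodule.starProjection_singleton]
      rfl
    rw [heq]
    refine (measurable_pi_apply i).sub (Finset.measurable_sum _ fun j hj => ?_)
    have hj' := ih j (Finset.mem_Iio.1 hj)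
    refine Measurable.smul (Measurable.div ?_ ?_) hj'
    · exact hj'.inner (measurable_pi_apply i)
    · exact hj'.norm.pow_const 2

theorem measurable_starProjection_span {t : ℕ} :
    Measurable fun p : (Fin t → E) × E =>
      (Submodule.span ℝ (Set.range p.1)).starProjection p.2 := by
  simp_rw [starProjection_span_eq_sum_gramSchmidt]
  refine Finset.measurable_sum _ fun i _ => ?_
  have h : Measurable fun p : (Fin t → E) × E => InnerProductSpace.gramSchmidt ℝ p.1 i :=
    (measurable_gramSchmidt i).comp measurable_fst
  exact ((h.inner measurable_snd).div (h.norm.pow_const 2)).smul h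

end Projection

/-! ### The isotropic Gaussian: splitting along a subspace, and moments -/

section Prior

variable {d : ℕ}

/-- The isotropic Gaussian `N(0, S² I)`. -/
noncomputable abbrev prior (d : ℕ) (S : ℝ) : Measure (EuclideanSpace ℝ (Fin d)) :=
  multivariateGaussian 0 (S ^ 2 • (1 : Matrix (Fin d) (Fin d) ℝ))

theorem posSemidef_sq_smul_one (S : ℝ) :
    (S ^ 2 • (1 : Matrix (Fin d) (Fin d) ℝ)).PosSemidef :=
  Matrix.PosSemidef.one.smul (sq_nonneg S)

theorem dotProduct_sq_smul_one_mulVec (S : ℝ) (x : EuclideanSpace ℝ (Fin d)) :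
    x.ofLp ⬝ᵥ (S ^ 2 • (1 : Matrix (Fin d) (Fin d) ℝ)).mulVec x.ofLp = S ^ 2 * ‖x‖ ^ 2 := by
  rw [Matrix.smul_mulVec, Matrix.one_mulVec, dotProduct_smul, EuclideanSpace.real_norm_sq_eq]
  simp [dotProduct, sq]

theorem charFun_prior (S : ℝ) (x : EuclideanSpace ℝ (Fin d)) :
    charFun (prior d S) x = Complex.exp (-((S ^ 2 * ‖x‖ ^ 2 : ℝ) : ℂ) / 2) := by
  rw [charFun_multivariateGaussian (posSemidef_sq_smul_one S), dotProduct_sq_smul_one_mulVec]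
  simp [neg_div]

/-- The characteristic function is the exponential of a multiple of `‖x‖²`, so Pythagoras factors it
over `K` and `Kᗮ`. This lets the component in `Kᗮ` be resampled from an independent copy. -/
theorem map_starProjection_add_prior (S : ℝ) (K : Submodule ℝ (EuclideanSpace ℝ (Fin d))) :
    ((prior d S).prod (prior d S)).map
      (fun p => K.starProjection p.1 + Kᗮ.starProjection p.2) = prior d S := by
  have hK (L : Submodule ℝ (EuclideanSpace ℝ (Fin d))) (x : EuclideanSpace ℝ (Fin d)) :
      charFun ((prior d S).map L.starProjection) x =
        charFun (prior d S) (L.starProjection x) := by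
    rw [charFun_apply, charFun_apply, integral_map (by fun_prop) (by fun_prop)]
    simp_rw [Submodule.inner_starProjection_left_eq_right]
  refine Measure.ext_of_charFun (funext fun x => ?_)
  have hmap : ((prior d S).prod (prior d S)).map
      (fun p => K.starProjection p.1 + Kᗮ.starProjection p.2) =
      (((prior d S).map K.starProjection).prod ((prior d S).map Kᗮ.starProjection)).map
        (fun p => p.1 + p.2) := by
    rw [Measure.map_prod_map _ _ (by fun_prop) (by fun_prop),
      Measure.map_map (by fun_prop) (by fun_prop)]
    rfl
  rw [hmap, charFun_map_add_prod_eq_mul, Pi.mul_apply, hK, hK, charFun_prior, charFun_prior,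
    charFun_prior, ← Complex.exp_add, K.norm_sq_eq_add_norm_sq_starProjection x]
  congr 1
  push_cast
  ring

theorem lintegral_starProjection_add_prior (S : ℝ)
    (K : Submodule ℝ (EuclideanSpace ℝ (Fin d))) {f : EuclideanSpace ℝ (Fin d) → ENNReal}
    (hf : Measurable f) :
    ∫⁻ x, f x ∂(prior d S) =
      ∫⁻ x, ∫⁻ y, f (K.starProjection x + Kᗮ.starProjection y) ∂(prior d S) ∂(prior d S) := by
  conv_lhs => rw [← map_starProjection_add_prior S K]
  rw [lintegral_map hf (by fun_prop), lintegral_prod _ (by fun_prop)]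

theorem integral_inner_prior (S : ℝ) (v : EuclideanSpace ℝ (Fin d)) :
    ∫ x, ⟪v, x⟫ ∂(prior d S) = 0 := by
  have h := IsGaussian.integral_dual (μ := prior d S) (innerSL ℝ v)
  rw [integral_id_multivariateGaussian, map_zero] at h
  exact h

theorem integral_inner_sq_prior (S : ℝ) (v : EuclideanSpace ℝ (Fin d)) :
    ∫ x, ⟪v, x⟫ ^ 2 ∂(prior d S) = S ^ 2 * ‖v‖ ^ 2 := by
  have h := covarianceBilin_self (μ := prior d S) IsGaussian.memLp_two_id v
  rw [covarianceBilin_multivariateGaussian (posSemidef_sq_smul_one S),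
    dotProduct_sq_smul_one_mulVec, variance_of_integral_eq_zero (by fun_prop)
      (integral_inner_prior S v)] at h
  exact h.symm

theorem memLp_id_prior (S : ℝ) : MemLp (fun x => x) 2 (prior d S) :=
  IsGaussian.memLp_two_id

theorem integral_norm_sq_starProjection_prior (S : ℝ)
    (K : Submodule ℝ (EuclideanSpace ℝ (Fin d))) :
    ∫ x, ‖K.starProjection x‖ ^ 2 ∂(prior d S) = S ^ 2 * Module.finrank ℝ K := by
  have h (x : EuclideanSpace ℝ (Fin d)) : ‖K.starProjection x‖ ^ 2 =
      ∑ i, ⟪(stdOrthonormalBasis ℝ K i : EuclideanSpace ℝ (Fin d)), x⟫ ^ 2 := by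
    have h1 : ‖K.starProjection x‖ = ‖K.orthogonalProjectionOnto x‖ := rfl
    rw [h1, ← (stdOrthonormalBasis ℝ K).sum_sq_inner_right]
    simp
  simp_rw [h]
  rw [integral_finsetSum]
  · have hb i : ‖(stdOrthonormalBasis ℝ K i : EuclideanSpace ℝ (Fin d))‖ = 1 :=
      (stdOrthonormalBasis ℝ K).norm_eq_one i
    simp [integral_inner_sq_prior, hb, mul_comm]
  · intro i _
    exact ((memLp_id_prior S).const_inner _).integrable_sq

theorem integral_norm_sq_prior (S : ℝ) :
    ∫ x, ‖x‖ ^ 2 ∂(prior d S) = S ^ 2 * d := by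
  have h := integral_norm_sq_starProjection_prior (d := d) S ⊤
  simp only [finrank_top, finrank_euclideanSpace, Fintype.card_fin] at h
  rw [← h]
  refine integral_congr_ae (.of_forall fun x => ?_)
  simp only
  rw [Submodule.starProjection_eq_self_iff.2 Submodule.mem_top]

/-- The first absolute moment of the standard Gaussian. -/
noncomputable def gaussianAbsMoment : ℝ := ∫ x, |x| ∂(gaussianReal 0 1)

theorem gaussianAbsMoment_pos : 0 < gaussianAbsMoment := by
  have hi : Integrable (fun x : ℝ => |x|) (gaussianReal 0 1) :=
    (IsGaussian.integrable_id (μ := gaussianReal 0 1)).abs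
  rw [gaussianAbsMoment, integral_pos_iff_support_of_nonneg (fun x => abs_nonneg x) hi]
  have hs : Function.support (fun x : ℝ => |x|) = {0}ᶜ := by
    ext x; simp
  have := nullSingletonClass_gaussianReal (μ := 0) (v := 1) one_ne_zero
  rw [hs, measure_compl (measurableSet_singleton 0) (by simp)]
  simp

theorem integral_abs_eval_prior {S : ℝ} (hS : 0 ≤ S) (i : Fin d) :
    ∫ x, |x i| ∂(prior d S) = S * gaussianAbsMoment := by
  have hmp := measurePreserving_eval_multivariateGaussian (μ := 0)
    (posSemidef_sq_smul_one (d := d) S) (i := i)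
  have h1 : ∫ x, |x i| ∂(prior d S) = ∫ y, |y| ∂((prior d S).map fun x => x i) :=
    (integral_map (by fun_prop) (by fun_prop)).symm
  have h2 := gaussianReal_map_const_mul (μ := 0) (v := 1) S
  rw [h1, hmp.map_eq]
  have h3 : gaussianReal ((0 : EuclideanSpace ℝ (Fin d)) i)
      ((S ^ 2 • (1 : Matrix (Fin d) (Fin d) ℝ)) i i).toNNReal =
      (gaussianReal 0 1).map (S * ·) := by
    rw [h2]
    congr 1
    · simp
    · ext; simp [sq_nonneg]
  rw [h3, integral_map (by fun_prop) (by fun_prop), gaussianAbsMoment, ← integral_const_mul]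
  simp_rw [abs_mul, abs_of_nonneg hS]

/-- Cauchy–Schwarz bounds the `ℓ¹` norm by `√d ‖x‖`, and the expected `ℓ¹` norm is computed
coordinatewise. -/
theorem le_integral_norm_prior {S : ℝ} (hS : 0 ≤ S) :
    S * gaussianAbsMoment * √d ≤ ∫ x, ‖x‖ ∂(prior d S) := by
  rcases Nat.eq_zero_or_pos d with rfl | hd
  · simpa using integral_nonneg fun x => norm_nonneg x
  have hpt (x : EuclideanSpace ℝ (Fin d)) : ∑ i, |x i| ≤ √d * ‖x‖ := by
    refine (sq_le_sq₀ (by positivity) (by positivity)).1 ?_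
    rw [mul_pow, Real.sq_sqrt (by positivity), EuclideanSpace.real_norm_sq_eq]
    simpa using sq_sum_le_card_mul_sum_sq (s := Finset.univ) (f := fun i => |x i|)
  have hx : Integrable (fun x => x) (prior d S) := IsGaussian.integrable_id
  have hint := integral_mono (μ := prior d S)
    (integrable_finsetSum Finset.univ fun i _ =>
      ((EuclideanSpace.proj (𝕜 := ℝ) i).integrable_comp hx).abs)
    (hx.norm.const_mul (√d)) hpt
  have hsum : ∫ x : EuclideanSpace ℝ (Fin d), ∑ i, |x i| ∂(prior d S) =
      d * (S * gaussianAbsMoment) := by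
    rw [integral_finsetSum _ fun i _ => by
      exact ((EuclideanSpace.proj (𝕜 := ℝ) i).integrable_comp hx).abs]
    simp [integral_abs_eval_prior hS]
  rw [integral_const_mul, hsum] at hint
  have hd' : 0 < √(d : ℝ) := Real.sqrt_pos.2 (by positivity)
  refine le_of_mul_le_mul_left ?_ hd'
  calc √d * (S * gaussianAbsMoment * √d) = (√d * √d) * (S * gaussianAbsMoment) := by ring
    _ = d * (S * gaussianAbsMoment) := by rw [Real.mul_self_sqrt (by positivity)]
    _ ≤ _ := hint
end Prior

/-! ### The law of the bandit with a fresh copy of the prior on the unexplored directions -/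

section Latent

variable {d : ℕ} {𝒜 : Set (EuclideanSpace ℝ (Fin d))}

/-- The span of the actions played in a history. -/
def actionSpan {t : ℕ} (h : History 𝒜 t) : Submodule ℝ (EuclideanSpace ℝ (Fin d)) :=
  Submodule.span ℝ (Set.range fun i => ((h i).1 : EuclideanSpace ℝ (Fin d)))

theorem finrank_actionSpan_le {t : ℕ} (h : History 𝒜 t) :
    Module.finrank ℝ (actionSpan h) ≤ t := by
  have := finrank_range_le_card (R := ℝ) fun i => ((h i).1 : EuclideanSpace ℝ (Fin d))
  rwa [Fintype.card_fin] at this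

theorem actionSpan_snoc {t : ℕ} (h : History 𝒜 t) (a : 𝒜) (w : ℝ) :
    actionSpan (Fin.snoc (α := fun _ => 𝒜 × ℝ) h (a, w) : History 𝒜 (t + 1)) =
      actionSpan h ⊔ Submodule.span ℝ {(a : EuclideanSpace ℝ (Fin d))} := by
  rw [actionSpan, actionSpan, ← Submodule.span_union]
  congr 1
  ext x
  simp only [Set.mem_range, Set.union_singleton, Set.mem_insert_iff]
  constructor
  · rintro ⟨i, rfl⟩
    refine Fin.lastCases ?_ (fun j => ?_) i
    · simp
    · simp
  · rintro (rfl | ⟨i, rfl⟩)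
    · exact ⟨Fin.last t, by simp⟩
    · exact ⟨i.castSucc, by simp⟩

/-- The projection of `x` onto the span of the actions played in the history `h`. -/
noncomputable def explored {t : ℕ} (h : History 𝒜 t) (x : EuclideanSpace ℝ (Fin d)) :
    EuclideanSpace ℝ (Fin d) :=
  (actionSpan h).starProjection x

/-- The component of `x` orthogonal to all actions played in the history `h`. -/
noncomputable def unexplored {t : ℕ} (h : History 𝒜 t) (x : EuclideanSpace ℝ (Fin d)) :
    EuclideanSpace ℝ (Fin d) :=
  (actionSpan h)ᗮ.starProjection x

@[fun_prop]
theorem measurable_explored {t : ℕ} {α : Type*} [MeasurableSpace α]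
    {f : α → History 𝒜 t} {g : α → EuclideanSpace ℝ (Fin d)} (hf : Measurable f)
    (hg : Measurable g) : Measurable fun x => explored (f x) (g x) := by
  have hf' : Measurable fun x i => ((f x i).1 : EuclideanSpace ℝ (Fin d)) :=
    measurable_pi_lambda _ fun i =>
      measurable_subtype_coe.comp ((measurable_pi_apply i).comp hf).fst
  have h := (measurable_starProjection_span (E := EuclideanSpace ℝ (Fin d)) (t := t)).comp
    (hf'.prodMk hg)
  simp only [explored, actionSpan]
  exact h

@[fun_prop]
theorem measurable_unexplored {t : ℕ} {α : Type*} [MeasurableSpace α]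
    {f : α → History 𝒜 t} {g : α → EuclideanSpace ℝ (Fin d)} (hf : Measurable f)
    (hg : Measurable g) : Measurable fun x => unexplored (f x) (g x) := by
  have h : (fun x => unexplored (f x) (g x)) = fun x => g x - explored (f x) (g x) := by
    funext x
    rw [unexplored, explored, Submodule.starProjection_orthogonal_val]
  rw [h]
  fun_prop

theorem norm_unexplored_le {t : ℕ} (h : History 𝒜 t) (x : EuclideanSpace ℝ (Fin d)) :
    ‖unexplored h x‖ ≤ ‖x‖ :=
  Submodule.norm_starProjection_apply_le _ _

/-- The part of the parameter that the rewards may depend on after one more action. -/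
noncomputable def latentUpdate {t : ℕ}
    (q : (((EuclideanSpace ℝ (Fin d) × History 𝒜 t) × 𝒜) × ℝ) × EuclideanSpace ℝ (Fin d)) :
    EuclideanSpace ℝ (Fin d) :=
  q.1.1.1.1 + unexplored q.1.1.1.2 ((actionSpan q.1.1.1.2 ⊔ Submodule.span ℝ
    {(q.1.1.2 : EuclideanSpace ℝ (Fin d))}).starProjection q.2)

/-- Action kernel of a policy, seen as a kernel from pairs (parameter, history). -/
noncomputable abbrev Policy.kernel (π : Policy 𝒜) (t : ℕ) :
    Kernel (EuclideanSpace ℝ (Fin d) × History 𝒜 t) 𝒜 :=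
  (π.action t).comap Prod.snd measurable_snd

/-- The enlarged span is the action span of the extended history, so measurability of `explored`
applies. -/
theorem measurable_latentUpdate {t : ℕ} : Measurable (latentUpdate (𝒜 := 𝒜) (t := t)) := by
  have h : latentUpdate (𝒜 := 𝒜) (t := t) = fun q => q.1.1.1.1 + unexplored q.1.1.1.2
      (explored (extend q.1).2 q.2) := by
    funext q
    simp only [latentUpdate, explored, extend, actionSpan_snoc]
  rw [h]
  have := measurable_extend (𝒜 := 𝒜) (t := t)
  fun_prop

/-- The joint law of `(x, H_t)` such that `(x + Q ξ, H_t)` has the law of `(θ, H_t)`, where `ξ` is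
a fresh copy of the prior and `Q` projects orthogonally to the actions played in `H_t`. -/
noncomputable def latent (S : ℝ) (σ : ℝ≥0) (π : Policy 𝒜) :
    (t : ℕ) → Measure (EuclideanSpace ℝ (Fin d) × History 𝒜 t)
  | 0 => Measure.dirac (0, Fin.elim0)
  | t + 1 =>
      (((latent S σ π t ⊗ₘ π.kernel t).prod (gaussianReal 0 (σ ^ 2))).prod (prior d S)).map
        fun q => extend (((latentUpdate q, q.1.1.1.2), q.1.1.2), q.1.2)

theorem measurable_latent_step {t : ℕ} :
    Measurable fun q : (((EuclideanSpace ℝ (Fin d) × History 𝒜 t) × 𝒜) × ℝ) ×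
      EuclideanSpace ℝ (Fin d) => extend (((latentUpdate q, q.1.1.1.2), q.1.1.2), q.1.2) := by
  have := measurable_extend (𝒜 := 𝒜) (t := t)
  have := measurable_latentUpdate (𝒜 := 𝒜) (t := t)
  fun_prop

instance isProbabilityMeasure_latent (S : ℝ) (σ : ℝ≥0) (π : Policy 𝒜) (t : ℕ) :
    IsProbabilityMeasure (latent S σ π t) := by
  induction t with
  | zero => unfold latent; infer_instance
  | succ t ih =>
    unfold latent
    exact Measure.isProbabilityMeasure_map measurable_latent_step.aemeasurable

/-- The action is drawn from the history alone, so the fresh copy stays independent of it and can be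
sampled afterwards. -/
theorem compProd_kernel_of_eq_map {S : ℝ} (π : Policy 𝒜) {t : ℕ}
    {μ ν : Measure (EuclideanSpace ℝ (Fin d) × History 𝒜 t)} [IsProbabilityMeasure μ]
    [IsProbabilityMeasure ν]
    (h : μ = (ν.prod (prior d S)).map fun p => (p.1.1 + unexplored p.1.2 p.2, p.1.2)) :
    μ ⊗ₘ π.kernel t = ((ν ⊗ₘ π.kernel t).prod (prior d S)).map
      fun p => ((p.1.1.1 + unexplored p.1.1.2 p.2, p.1.1.2), p.1.2) := by
  refine Measure.ext_of_lintegral _ fun f hf => ?_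
  have hm : Measurable fun z : EuclideanSpace ℝ (Fin d) × History 𝒜 t =>
      ∫⁻ a, f (z, a) ∂(π.kernel t z) := hf.lintegral_kernel_prod_right'
  have hmap : Measurable fun p : (EuclideanSpace ℝ (Fin d) × History 𝒜 t) ×
      EuclideanSpace ℝ (Fin d) => (p.1.1 + unexplored p.1.2 p.2, p.1.2) := by fun_prop
  have hmap' : Measurable fun p : ((EuclideanSpace ℝ (Fin d) × History 𝒜 t) × 𝒜) ×
      EuclideanSpace ℝ (Fin d) =>
        f ((p.1.1.1 + unexplored p.1.1.2 p.2, p.1.1.2), p.1.2) := by fun_prop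
  rw [Measure.lintegral_compProd hf, h, lintegral_map hm hmap,
    lintegral_prod _ (by exact (hm.comp hmap).aemeasurable), lintegral_map hf (by fun_prop),
    lintegral_prod _ hmap'.aemeasurable,
    Measure.lintegral_compProd hmap'.lintegral_prod_right']
  refine lintegral_congr fun z => ?_
  simp only [Policy.kernel, Kernel.comap_apply]
  rw [lintegral_lintegral_swap]
  fun_prop

/-- Pathwise form of the induction step. The part of the fresh vector in `Kᗮ` is orthogonal to the
new action, so it leaves the reward unchanged and is the unexplored part for the new history; the
part in `K` is absorbed by `latentUpdate`. -/
theorem extend_add_unexplored {t : ℕ}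
    (z : (EuclideanSpace ℝ (Fin d) × History 𝒜 t) × 𝒜) (w : ℝ)
    (ξ ξ' : EuclideanSpace ℝ (Fin d)) :
    let K := actionSpan z.1.2 ⊔ Submodule.span ℝ {(z.2 : EuclideanSpace ℝ (Fin d))}
    let y := extend (((latentUpdate ((z, w), ξ), z.1.2), z.2), w)
    extend (((z.1.1 + unexplored z.1.2 (K.starProjection ξ + Kᗮ.starProjection ξ'), z.1.2),
      z.2), w) = (y.1 + unexplored y.2 ξ', y.2) := by
  intro K y
  have hmem : Kᗮ.starProjection ξ' ∈ Kᗮ := Submodule.starProjection_apply_mem _ _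
  have h1 : (actionSpan z.1.2)ᗮ.starProjection (Kᗮ.starProjection ξ') = Kᗮ.starProjection ξ' :=
    Submodule.starProjection_eq_self_iff.2 (Submodule.orthogonal_le le_sup_left hmem)
  have h2 : ⟪Kᗮ.starProjection ξ', (z.2 : EuclideanSpace ℝ (Fin d))⟫ = 0 :=
    Submodule.inner_left_of_mem_orthogonal
      (Submodule.mem_sup_right (Submodule.mem_span_singleton_self _)) hmem
  have h3 : unexplored y.2 ξ' = Kᗮ.starProjection ξ' := by
    rw [unexplored]
    simp only [y, extend, actionSpan_snoc]
    rfl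
  have h4 : z.1.1 + unexplored z.1.2 (K.starProjection ξ + Kᗮ.starProjection ξ') =
      latentUpdate ((z, w), ξ) + Kᗮ.starProjection ξ' := by
    rw [unexplored, map_add, h1, latentUpdate, unexplored, add_assoc]
  rw [h3, h4]
  simp only [y, extend, inner_add_left, h2, add_zero]

theorem law_eq_map_latent (S : ℝ) (σ : ℝ≥0) (π : Policy 𝒜) (t : ℕ) :
    law (S ^ 2 • (1 : Matrix (Fin d) (Fin d) ℝ)) σ π t =
      ((latent S σ π t).prod (prior d S)).map
        fun p => (p.1.1 + unexplored p.1.2 p.2, p.1.2) := by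
  induction t with
  -- With no action played the span is zero, so the whole parameter is fresh.
  | zero =>
    have hq (h : History 𝒜 0) (x : EuclideanSpace ℝ (Fin d)) : unexplored h x = x := by
      have hbot : actionSpan h = ⊥ := by
        rw [actionSpan, Set.range_eq_empty, Submodule.span_empty]
      rw [unexplored, Submodule.starProjection_eq_self_iff, hbot, Submodule.bot_orthogonal_eq_top]
      exact Submodule.mem_top
    simp only [law, latent, hq]
    rw [Measure.dirac_prod, Measure.prod_dirac, Measure.map_map (by fun_prop) (by fun_prop)]
    congr 1
    funext x
    simp
  | succ t ih =>
    have hext := measurable_extend (𝒜 := 𝒜) (t := t)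
    refine Measure.ext_of_lintegral _ fun f hf => ?_
    have hmap : Measurable fun p : ((EuclideanSpace ℝ (Fin d) × History 𝒜 t) × 𝒜) ×
        EuclideanSpace ℝ (Fin d) =>
          ((p.1.1.1 + unexplored p.1.1.2 p.2, p.1.1.2), p.1.2) := by fun_prop
    have hstep := measurable_latent_step (𝒜 := 𝒜) (t := t)
    have hf1 : Measurable fun z : (EuclideanSpace ℝ (Fin d) × History 𝒜 t) × 𝒜 =>
        ∫⁻ w, f (extend (z, w)) ∂(gaussianReal 0 (σ ^ 2)) :=
      (hf.comp hext).lintegral_prod_right'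
    have hf2 : Measurable fun p : (EuclideanSpace ℝ (Fin d) × History 𝒜 (t + 1)) ×
        EuclideanSpace ℝ (Fin d) => f (p.1.1 + unexplored p.1.2 p.2, p.1.2) := by fun_prop
    have hf3 := hf2.lintegral_prod_right' (ν := prior d S)
    rw [law, lintegral_map hf hext, lintegral_prod _ (by exact (hf.comp hext).aemeasurable),
      compProd_kernel_of_eq_map π ih, lintegral_map hf1 hmap,
      lintegral_prod _ (by exact (hf1.comp hmap).aemeasurable), lintegral_map hf (by fun_prop),
      lintegral_prod _ hf2.aemeasurable, latent, lintegral_map hf3 hstep,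
      lintegral_prod _ (by exact (hf3.comp hstep).aemeasurable),
      lintegral_prod _ (by exact (hf3.comp hstep).lintegral_prod_right'.aemeasurable)]
    refine lintegral_congr fun z => ?_
    rw [lintegral_lintegral_swap (by
      simp only [Function.uncurry_def]
      fun_prop)]
    refine lintegral_congr fun w => ?_
    -- Split the fresh copy along the enlarged span: `ξ` feeds the latent update, `ξ'` is the next
    -- fresh copy.
    rw [lintegral_starProjection_add_prior S
      (actionSpan z.1.2 ⊔ Submodule.span ℝ {(z.2 : EuclideanSpace ℝ (Fin d))}) (by fun_prop)]
    refine lintegral_congr fun ξ => lintegral_congr fun ξ' => ?_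
    congr 1
    exact extend_add_unexplored z w ξ ξ'

end Latent

/-! ### Second moments of the latent part -/

section Moments

variable {d : ℕ} {𝒜 : Set (EuclideanSpace ℝ (Fin d))}

theorem measurePreserving_fst_law (Sigma0 : Matrix (Fin d) (Fin d) ℝ) (σ : ℝ≥0) (π : Policy 𝒜)
    (t : ℕ) : MeasurePreserving Prod.fst (law Sigma0 σ π t) (multivariateGaussian 0 Sigma0) := by
  induction t with
  | zero => exact measurePreserving_fst
  | succ t ih =>
    refine ⟨measurable_fst, ?_⟩
    have h1 : MeasurePreserving Prod.fst (law Sigma0 σ π t ⊗ₘ π.kernel t) (law Sigma0 σ π t) :=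
      ⟨measurable_fst, Measure.fst_compProd _ _⟩
    have h2 : MeasurePreserving Prod.fst ((law Sigma0 σ π t ⊗ₘ π.kernel t).prod
      (gaussianReal 0 (σ ^ 2))) (law Sigma0 σ π t ⊗ₘ π.kernel t) := measurePreserving_fst
    rw [law, Measure.map_map measurable_fst measurable_extend]
    exact (ih.comp (h1.comp h2)).map_eq

theorem memLp_fst_law (S : ℝ) (σ : ℝ≥0) (π : Policy 𝒜) (t : ℕ) :
    MemLp Prod.fst 2 (law (S ^ 2 • (1 : Matrix (Fin d) (Fin d) ℝ)) σ π t) :=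
  (memLp_id_prior S).comp_measurePreserving (measurePreserving_fst_law _ σ π t)

theorem memLp_unexplored {S : ℝ} {t : ℕ} (ν : Measure (EuclideanSpace ℝ (Fin d) × History 𝒜 t))
    [IsProbabilityMeasure ν] :
    MemLp (fun p => unexplored p.1.2 p.2) 2 (ν.prod (prior d S)) := by
  have h : MemLp (fun p => p.2) 2 (ν.prod (prior d S)) :=
    (memLp_id_prior S).comp_measurePreserving measurePreserving_snd
  refine h.of_le (Measurable.aestronglyMeasurable (by fun_prop)) (.of_forall fun p => norm_unexplored_le _ _)

/-- In the coupling `x = θ - Qξ`, a difference of two square-integrable vectors. -/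
theorem memLp_fst_latent (S : ℝ) (σ : ℝ≥0) (π : Policy 𝒜) (t : ℕ) :
    MemLp Prod.fst 2 (latent S σ π t) := by
  have h1 := memLp_fst_law S σ π t
  rw [law_eq_map_latent, memLp_map_measure_iff (by fun_prop) (by fun_prop)] at h1
  have h2 := h1.sub (memLp_unexplored (S := S) (latent S σ π t))
  have h3 : MemLp (Prod.fst ∘ Prod.fst) 2 ((latent S σ π t).prod (prior d S)) := by
    refine h2.ae_eq (.of_forall fun p => ?_)
    simp
  rwa [← memLp_map_measure_iff (by fun_prop) (by fun_prop), measurePreserving_fst.map_eq] at h3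

theorem integral_inner_unexplored (S : ℝ) {t : ℕ} (h : History 𝒜 t)
    (v : EuclideanSpace ℝ (Fin d)) : ∫ ξ, ⟪unexplored h ξ, v⟫ ∂(prior d S) = 0 := by
  rw [← integral_inner_prior S ((actionSpan h)ᗮ.starProjection v)]
  refine integral_congr_ae (.of_forall fun ξ => ?_)
  simp only
  rw [unexplored, Submodule.inner_starProjection_left_eq_right, real_inner_comm]

theorem le_integral_norm_sq_unexplored (S : ℝ) {t : ℕ} (h : History 𝒜 t) :
    S ^ 2 * (d - t) ≤ ∫ ξ, ‖unexplored h ξ‖ ^ 2 ∂(prior d S) := by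
  have h1 := integral_norm_sq_starProjection_prior S (actionSpan h)ᗮ
  have h2 : Module.finrank ℝ (actionSpan h) + Module.finrank ℝ (actionSpan h)ᗮ = d := by
    simpa using (actionSpan h).finrank_add_finrank_orthogonal
  have h3 : (d : ℝ) ≤ t + Module.finrank ℝ (actionSpan h)ᗮ := by
    exact_mod_cast (h2.symm.le.trans (Nat.add_le_add_right (finrank_actionSpan_le h) _))
  simp only [unexplored]
  rw [h1]
  exact mul_le_mul_of_nonneg_left (by linarith) (sq_nonneg S)

/-- Expand `E‖x + Qξ‖² = S²d`. The cross term vanishes by integrating over `ξ` first, and `E‖Qξ‖² ≥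
S²(d - t)` by counting dimensions. -/
theorem integral_norm_sq_latent_le (S : ℝ) (σ : ℝ≥0) (π : Policy 𝒜) (t : ℕ) :
    ∫ p, ‖p.1‖ ^ 2 ∂(latent S σ π t) ≤ S ^ 2 * t := by
  set ν := latent S σ π t
  have hx : MemLp (fun p : (EuclideanSpace ℝ (Fin d) × History 𝒜 t) × EuclideanSpace ℝ (Fin d) =>
      p.1.1) 2 (ν.prod (prior d S)) :=
    (memLp_fst_latent S σ π t).comp_measurePreserving measurePreserving_fst
  have hq := memLp_unexplored (S := S) ν
  have h1 : ∫ p, ‖p.1.1 + unexplored p.1.2 p.2‖ ^ 2 ∂(ν.prod (prior d S)) = S ^ 2 * d := by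
    have := (measurePreserving_fst_law (S ^ 2 • (1 : Matrix (Fin d) (Fin d) ℝ)) σ π t).map_eq
    rw [← integral_norm_sq_prior (d := d) S]
    conv_rhs => rw [prior, ← this]
    rw [integral_map (by fun_prop)
      (by fun_prop), law_eq_map_latent, integral_map (by fun_prop) (by fun_prop)]
  have hinner : Integrable (fun p : (EuclideanSpace ℝ (Fin d) × History 𝒜 t) ×
      EuclideanSpace ℝ (Fin d) => ⟪unexplored p.1.2 p.2, p.1.1⟫) (ν.prod (prior d S)) :=
    (hq.norm.integrable_mul hx.norm).mono' (Measurable.aestronglyMeasurable (by fun_prop))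
      (.of_forall fun p => norm_inner_le_norm _ _)
  have h2 : ∫ p, ⟪unexplored p.1.2 p.2, p.1.1⟫ ∂(ν.prod (prior d S)) = 0 := by
    rw [integral_prod _ hinner]
    simp [integral_inner_unexplored]
  have h3 : S ^ 2 * (d - t) ≤ ∫ p, ‖unexplored p.1.2 p.2‖ ^ 2 ∂(ν.prod (prior d S)) := by
    rw [integral_prod _ hq.norm.integrable_sq]
    calc S ^ 2 * ((d : ℝ) - t) = ∫ _, S ^ 2 * ((d : ℝ) - t) ∂ν := by simp
      _ ≤ _ := integral_mono (integrable_const _) hq.norm.integrable_sq.integral_prod_left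
        fun p => le_integral_norm_sq_unexplored S p.2
  have h4 : ∫ p, ‖p.1.1‖ ^ 2 ∂(ν.prod (prior d S)) = ∫ p, ‖p.1‖ ^ 2 ∂ν := by
    rw [integral_prod _ hx.norm.integrable_sq]
    simp
  have h5 : ∫ p, ‖p.1.1 + unexplored p.1.2 p.2‖ ^ 2 ∂(ν.prod (prior d S)) =
      ∫ p, ‖p.1.1‖ ^ 2 ∂(ν.prod (prior d S)) +
        2 * ∫ p, ⟪unexplored p.1.2 p.2, p.1.1⟫ ∂(ν.prod (prior d S)) +
        ∫ p, ‖unexplored p.1.2 p.2‖ ^ 2 ∂(ν.prod (prior d S)) := by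
    have hxi : Integrable (fun p : (EuclideanSpace ℝ (Fin d) × History 𝒜 t) ×
        EuclideanSpace ℝ (Fin d) => ‖p.1.1‖ ^ 2 + 2 * ⟪unexplored p.1.2 p.2, p.1.1⟫)
        (ν.prod (prior d S)) := hx.norm.integrable_sq.add (hinner.const_mul 2)
    rw [← integral_const_mul, ← integral_add hx.norm.integrable_sq (hinner.const_mul 2),
      ← integral_add hxi hq.norm.integrable_sq]
    refine integral_congr_ae (.of_forall fun p => ?_)
    simp only
    rw [norm_add_sq_real, real_inner_comm]
  rw [h1, h2, h4] at h5
  linarith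

theorem integral_le_sqrt_integral_sq {Ω : Type*} [MeasurableSpace Ω] {μ : Measure Ω}
    [IsProbabilityMeasure μ] {f : Ω → ℝ} (hf : MemLp f 2 μ) :
    ∫ x, f x ∂μ ≤ √(∫ x, f x ^ 2 ∂μ) := by
  have h := variance_nonneg f μ
  rw [variance_eq_sub hf] at h
  exact Real.le_sqrt_of_sq_le (by simpa using h)

end Moments

/-! ### Regret of one round and summation -/

section Regret

variable {d : ℕ} {r : ℝ}

theorem inner_aStar {θ a : EuclideanSpace ℝ (Fin d)} (hr : 0 ≤ r)
    (h : IsOptimalAction (Metric.closedBall 0 r) θ a) : ⟪θ, a⟫ = r * ‖θ‖ := by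
  obtain ⟨ha, hmax⟩ := h
  apply le_antisymm
  · calc ⟪θ, a⟫ ≤ ‖θ‖ * ‖a‖ := real_inner_le_norm θ a
      _ ≤ ‖θ‖ * r := by gcongr; simpa using ha
      _ = r * ‖θ‖ := mul_comm _ _
  · by_cases hθ : θ = 0
    · simp [hθ]
    have hθ' : ‖θ‖ ≠ 0 := by simpa using hθ
    refine le_trans (le_of_eq ?_) (hmax ((r / ‖θ‖) • θ) ?_)
    · rw [real_inner_smul_right, real_inner_self_eq_norm_sq]
      field_simp
    · rw [mem_closedBall_zero_iff, norm_smul, norm_div, norm_norm, div_mul_cancel₀ _ hθ',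
        Real.norm_of_nonneg hr]

theorem abs_inner_action_le (θ : EuclideanSpace ℝ (Fin d))
    (a : Metric.closedBall (0 : EuclideanSpace ℝ (Fin d)) r) : |⟪θ, (a : _)⟫| ≤ r * ‖θ‖ := by
  calc |⟪θ, (a : EuclideanSpace ℝ (Fin d))⟫| ≤ ‖θ‖ * ‖(a : EuclideanSpace ℝ (Fin d))‖ :=
        abs_real_inner_le_norm _ _
    _ ≤ ‖θ‖ * r := by gcongr; exact mem_closedBall_zero_iff.1 a.2
    _ = r * ‖θ‖ := mul_comm _ _

variable (S : ℝ) (σ : ℝ≥0) (π : Policy (Metric.closedBall (0 : EuclideanSpace ℝ (Fin d)) r)) (t : ℕ)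

theorem measurePreserving_fst_compProd_kernel
    (μ : Measure (EuclideanSpace ℝ (Fin d) × History (Metric.closedBall 0 r) t))
    [IsProbabilityMeasure μ] : MeasurePreserving Prod.fst (μ ⊗ₘ π.kernel t) μ :=
  ⟨measurable_fst, Measure.fst_compProd _ _⟩

theorem integrable_inner_action
    {μ : Measure (EuclideanSpace ℝ (Fin d) × History (Metric.closedBall 0 r) t)}
    [IsProbabilityMeasure μ] (hμ : MemLp Prod.fst 2 μ) :
    Integrable (fun z => ⟪z.1.1, (z.2 : EuclideanSpace ℝ (Fin d))⟫) (μ ⊗ₘ π.kernel t) := by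
  have h1 : Integrable (fun z => z.1.1) (μ ⊗ₘ π.kernel t) :=
    (measurePreserving_fst_compProd_kernel π t μ).integrable_comp_of_integrable
      (hμ.integrable one_le_two)
  refine (h1.norm.const_mul r).mono' (by fun_prop) (.of_forall fun z => ?_)
  exact abs_inner_action_le _ _

/-- Averaging over the fresh copy replaces `θ` by its latent part; Cauchy–Schwarz and the
second-moment bound finish. -/
theorem integral_inner_action_le (hr : 0 ≤ r) (hS : 0 ≤ S) :
    ∫ z, ⟪z.1.1, (z.2 : EuclideanSpace ℝ (Fin d))⟫
      ∂(law (S ^ 2 • (1 : Matrix (Fin d) (Fin d) ℝ)) σ π t ⊗ₘ π.kernel t) ≤ r * (S * √t) := by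
  have hlaw := integrable_inner_action π t (memLp_fst_law S σ π t)
  have hlat := integrable_inner_action π t (memLp_fst_latent S σ π t)
  have hmap := compProd_kernel_of_eq_map π (law_eq_map_latent S σ π t)
  rw [hmap, integrable_map_measure (by fun_prop) (by fun_prop)] at hlaw
  rw [hmap, integral_map (by fun_prop) (by fun_prop), integral_prod _ (by exact hlaw)]
  have hinner (z : (EuclideanSpace ℝ (Fin d) × History (Metric.closedBall 0 r) t) ×
      Metric.closedBall (0 : EuclideanSpace ℝ (Fin d)) r) :
      ∫ ξ, ⟪z.1.1 + unexplored z.1.2 ξ, (z.2 : EuclideanSpace ℝ (Fin d))⟫ ∂(prior d S) =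
        ⟪z.1.1, (z.2 : EuclideanSpace ℝ (Fin d))⟫ := by
    have hint : Integrable (fun ξ => unexplored z.1.2 ξ) (prior d S) :=
      ((actionSpan z.1.2)ᗮ.starProjection).integrable_comp
        ((memLp_id_prior S).integrable one_le_two)
    simp_rw [inner_add_left]
    rw [integral_add (integrable_const _) (hint.inner_const _), integral_inner_unexplored]
    simp
  simp only [hinner]
  have hx := memLp_fst_latent S σ π t
  have hnorm : Integrable (fun p => r * ‖p.1‖) (latent S σ π t) :=
    (hx.integrable one_le_two).norm.const_mul r
  have hmp := measurePreserving_fst_compProd_kernel π t (latent S σ π t)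
  calc ∫ z, ⟪z.1.1, (z.2 : EuclideanSpace ℝ (Fin d))⟫ ∂(latent S σ π t ⊗ₘ π.kernel t)
      ≤ ∫ z, r * ‖z.1.1‖ ∂(latent S σ π t ⊗ₘ π.kernel t) :=
        integral_mono hlat (hmp.integrable_comp_of_integrable hnorm)
          fun z => (le_abs_self _).trans (abs_inner_action_le _ _)
    _ = ∫ p, r * ‖p.1‖ ∂(latent S σ π t) := by
        conv_rhs => rw [← hmp.map_eq]
        rw [integral_map (by fun_prop) (by fun_prop)]
    _ = r * ∫ p, ‖p.1‖ ∂(latent S σ π t) := integral_const_mul _ _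
    _ ≤ r * √(∫ p, ‖p.1‖ ^ 2 ∂(latent S σ π t)) := by
        gcongr
        exact integral_le_sqrt_integral_sq hx.norm
    _ ≤ r * √(S ^ 2 * t) := by
        gcongr
        exact integral_norm_sq_latent_le S σ π t
    _ = r * (S * √t) := by rw [Real.sqrt_mul (sq_nonneg S), Real.sqrt_sq hS]

variable {aStar : EuclideanSpace ℝ (Fin d) → EuclideanSpace ℝ (Fin d)}

/-- This removes `aStar`, which is not assumed measurable, from the integrand. -/
theorem instantRegret_eq (hr : 0 ≤ r)
    (ha : ∀ θ, IsOptimalAction (Metric.closedBall 0 r) θ (aStar θ)) :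
    instantRegret (𝒜 := Metric.closedBall 0 r) aStar t =
      fun x => r * ‖x.1‖ - (x.2 (Fin.last t)).2 := by
  funext x
  rw [instantRegret, inner_aStar hr (ha _)]

theorem integrable_norm_law :
    Integrable (fun z => r * ‖z.1.1‖)
      (law (S ^ 2 • (1 : Matrix (Fin d) (Fin d) ℝ)) σ π t ⊗ₘ π.kernel t) :=
  (measurePreserving_fst_compProd_kernel π t _).integrable_comp_of_integrable
    (((memLp_fst_law S σ π t).integrable one_le_two).norm.const_mul r)

theorem integrable_regret_prod :
    Integrable (fun q => r * ‖q.1.1.1‖ - (⟪q.1.1.1, (q.1.2 : EuclideanSpace ℝ (Fin d))⟫ + q.2))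
      ((law (S ^ 2 • (1 : Matrix (Fin d) (Fin d) ℝ)) σ π t ⊗ₘ π.kernel t).prod
        (gaussianReal 0 (σ ^ 2))) := by
  have h1 := (integrable_norm_law S σ π t).comp_fst (gaussianReal 0 (σ ^ 2))
  have h2 := (integrable_inner_action π t (memLp_fst_law S σ π t)).comp_fst
    (gaussianReal 0 (σ ^ 2))
  have h3 : Integrable (fun w : ℝ => w) (gaussianReal 0 (σ ^ 2)) := IsGaussian.integrable_id
  exact h1.sub (h2.add (h3.comp_snd _))

theorem integrable_instantRegret (hr : 0 ≤ r)
    (ha : ∀ θ, IsOptimalAction (Metric.closedBall 0 r) θ (aStar θ)) :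
    Integrable (instantRegret aStar t)
      (law (S ^ 2 • (1 : Matrix (Fin d) (Fin d) ℝ)) σ π (t + 1)) := by
  rw [instantRegret_eq t hr ha, law,
    integrable_map_measure (by fun_prop) measurable_extend.aemeasurable]
  convert integrable_regret_prod S σ π t using 1
  funext q
  simp [extend]

theorem integral_instantRegret (hr : 0 ≤ r)
    (ha : ∀ θ, IsOptimalAction (Metric.closedBall 0 r) θ (aStar θ)) :
    ∫ x, instantRegret aStar t x ∂(law (S ^ 2 • (1 : Matrix (Fin d) (Fin d) ℝ)) σ π (t + 1)) =
      r * ∫ θ, ‖θ‖ ∂(prior d S) - ∫ z, ⟪z.1.1, (z.2 : EuclideanSpace ℝ (Fin d))⟫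
        ∂(law (S ^ 2 • (1 : Matrix (Fin d) (Fin d) ℝ)) σ π t ⊗ₘ π.kernel t) := by
  have hmp := (measurePreserving_fst_law (S ^ 2 • (1 : Matrix (Fin d) (Fin d) ℝ)) σ π t).comp
    (measurePreserving_fst_compProd_kernel π t _)
  have hnorm : r * ∫ θ, ‖θ‖ ∂(prior d S) = ∫ z, r * ‖z.1.1‖
      ∂(law (S ^ 2 • (1 : Matrix (Fin d) (Fin d) ℝ)) σ π t ⊗ₘ π.kernel t) := by
    rw [integral_const_mul, prior, ← hmp.map_eq, integral_map (by fun_prop) (by fun_prop)]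
    rfl
  have hi := integrable_inner_action π t (memLp_fst_law S σ π t)
  have hw : Integrable (fun w : ℝ => w) (gaussianReal 0 (σ ^ 2)) := IsGaussian.integrable_id
  have hw0 : ∫ w : ℝ, w ∂(gaussianReal 0 (σ ^ 2)) = 0 := integral_id_gaussianReal
  rw [hnorm, ← integral_sub (integrable_norm_law S σ π t) hi, instantRegret_eq t hr ha, law,
    integral_map measurable_extend.aemeasurable (by fun_prop)]
  simp only [extend, Fin.snoc_last]
  rw [integral_prod _ (integrable_regret_prod S σ π t)]
  refine integral_congr_ae (.of_forall fun z => ?_)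
  simp only
  rw [integral_sub (integrable_const _) (by exact (integrable_const _).add hw),
    integral_add (integrable_const _) hw, hw0]
  simp

theorem integral_instantRegret_nonneg (hr : 0 ≤ r)
    (ha : ∀ θ, IsOptimalAction (Metric.closedBall 0 r) θ (aStar θ)) :
    0 ≤ ∫ x, instantRegret aStar t x
      ∂(law (S ^ 2 • (1 : Matrix (Fin d) (Fin d) ℝ)) σ π (t + 1)) := by
  have hmp := (measurePreserving_fst_law (S ^ 2 • (1 : Matrix (Fin d) (Fin d) ℝ)) σ π t).comp
    (measurePreserving_fst_compProd_kernel π t _)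
  rw [integral_instantRegret S σ π t hr ha, sub_nonneg, prior, ← hmp.map_eq,
    integral_map (by fun_prop) (by fun_prop), ← integral_const_mul]
  exact integral_mono (integrable_inner_action π t (memLp_fst_law S σ π t))
    (integrable_norm_law S σ π t) fun z => (le_abs_self _).trans (abs_inner_action_le _ _)

theorem le_integral_instantRegret (hr : 0 ≤ r) (hS : 0 ≤ S)
    (ha : ∀ θ, IsOptimalAction (Metric.closedBall 0 r) θ (aStar θ)) :
    r * S * (gaussianAbsMoment * √d - √t) ≤ ∫ x, instantRegret aStar t x
      ∂(law (S ^ 2 • (1 : Matrix (Fin d) (Fin d) ℝ)) σ π (t + 1)) := by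
  rw [integral_instantRegret S σ π t hr ha]
  have h1 := integral_inner_action_le S σ π t hr hS
  have h2 := mul_le_mul_of_nonneg_left (le_integral_norm_prior (d := d) hS) hr
  linarith

theorem le_bayesRegret (hr : 0 ≤ r) (hS : 0 ≤ S) {κ : ℝ} (hκ : 0 ≤ κ) (hκ1 : κ ≤ 1)
    (hκm : κ ≤ gaussianAbsMoment)
    (ha : ∀ θ, IsOptimalAction (Metric.closedBall 0 r) θ (aStar θ)) (T : ℕ) :
    κ ^ 3 / 8 * (S * r * √d * (min T d : ℕ)) ≤
      bayesRegret (S ^ 2 • (1 : Matrix (Fin d) (Fin d) ℝ)) σ aStar π T := by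
  -- The threshold is where `√t ≤ κ√d / 2`, so half of the gain survives. The `+ 1` counts round `0`
  -- and makes the number of rounds at least `κ²d / 4` before capping at `T`.
  set m := min T (⌊κ ^ 2 * d / 4⌋₊ + 1) with hm
  have hround (t : ℕ) (ht : t < m) : r * S * (κ * √d / 2) ≤ ∫ x, instantRegret aStar t x
      ∂(law (S ^ 2 • (1 : Matrix (Fin d) (Fin d) ℝ)) σ π (t + 1)) := by
    refine le_trans ?_ (le_integral_instantRegret S σ π t hr hS ha)
    have ht' : (t : ℝ) ≤ κ ^ 2 * d / 4 :=
      (Nat.le_floor_iff (by positivity)).1 (Nat.lt_succ_iff.1 (ht.trans_le (min_le_right _ _)))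
    have hsqrt : √t ≤ κ * √d / 2 := by
      rw [Real.sqrt_le_left (by positivity), div_pow, mul_pow, Real.sq_sqrt (by positivity)]
      linarith
    have : κ * √d ≤ gaussianAbsMoment * √d := by gcongr
    gcongr
    linarith
  have hcount : κ ^ 2 / 4 * (min T d : ℕ) ≤ m := by
    have hmin : κ ^ 2 / 4 ≤ 1 := by nlinarith
    rw [hm, Nat.cast_min, Nat.cast_min]
    refine le_min ?_ ?_
    · calc κ ^ 2 / 4 * min (T : ℝ) d ≤ 1 * T := by gcongr; exact min_le_left _ _
        _ = T := one_mul _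
    · calc κ ^ 2 / 4 * min (T : ℝ) d ≤ κ ^ 2 / 4 * d := by gcongr; exact min_le_right _ _
        _ = κ ^ 2 * d / 4 := by ring
        _ ≤ _ := by exact_mod_cast (Nat.lt_floor_add_one _).le
  calc κ ^ 3 / 8 * (S * r * √d * (min T d : ℕ))
      = κ ^ 2 / 4 * (min T d : ℕ) * (r * S * (κ * √d / 2)) := by ring
    _ ≤ m * (r * S * (κ * √d / 2)) := by gcongr
    _ = ∑ t ∈ Finset.range m, r * S * (κ * √d / 2) := by simp
    _ ≤ ∑ t ∈ Finset.range m, ∫ x, instantRegret aStar t x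
          ∂(law (S ^ 2 • (1 : Matrix (Fin d) (Fin d) ℝ)) σ π (t + 1)) :=
        Finset.sum_le_sum fun t ht => hround t (Finset.mem_range.1 ht)
    _ ≤ _ := Finset.sum_le_sum_of_subset_of_nonneg
        (Finset.range_subset_range.2 (min_le_left _ _))
        fun t _ _ => integral_instantRegret_nonneg S σ π t hr ha

end Regret
end LinGaussBandit

theorem mainTheorem6 :
    ∃ c : ℝ, 0 < c ∧
      ∀ (d : ℕ) (_ : 1 ≤ d) (r S : ℝ) (_ : 0 ≤ r) (_ : 0 ≤ S) (σ : ℝ≥0)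
        (Sigma0 : Matrix (Fin d) (Fin d) ℝ) (_ : Sigma0 = S ^ 2 • (1 : Matrix (Fin d) (Fin d) ℝ))
        (aStar : EuclideanSpace ℝ (Fin d) → EuclideanSpace ℝ (Fin d))
        (_ : ∀ θ, LinGaussBandit.IsOptimalAction (Metric.closedBall 0 r) θ (aStar θ))
        (π : LinGaussBandit.Policy (Metric.closedBall (0 : EuclideanSpace ℝ (Fin d)) r)) (T : ℕ),
        (∀ t < T, Integrable (LinGaussBandit.instantRegret aStar t)
          (LinGaussBandit.law Sigma0 σ π (t + 1))) ∧
        c * (S * r * (d : ℝ) ^ (-(1 / 2) : ℝ) * ((min T d : ℕ) : ℝ) ^ 2) ≤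
          LinGaussBandit.bayesRegret Sigma0 σ aStar π T := by
  -- Capping at `1` gives `κ²/4 ≤ 1`, used when `T` is the smaller count, without evaluating the
  -- moment.
  have hκ : 0 < min LinGaussBandit.gaussianAbsMoment 1 :=
    lt_min LinGaussBandit.gaussianAbsMoment_pos one_pos
  refine ⟨min LinGaussBandit.gaussianAbsMoment 1 ^ 3 / 8, by positivity, ?_⟩
  rintro d hd r S hr hS σ _ rfl aStar ha π T
  refine ⟨fun t _ => LinGaussBandit.integrable_instantRegret S σ π t hr ha, ?_⟩
  refine le_trans ?_ (LinGaussBandit.le_bayesRegret S σ π hr hS hκ.le (min_le_right _ _)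
    (min_le_left _ _) ha T)
  have hd' : (0 : ℝ) < d := by exact_mod_cast hd
  have hpow : (d : ℝ) ^ (-(1 / 2) : ℝ) * d = √d := by
    rw [← Real.rpow_add_one hd'.ne', Real.sqrt_eq_rpow]
    norm_num
  have hmin : ((min T d : ℕ) : ℝ) ≤ d := by exact_mod_cast min_le_right T d
  -- The bound proved is stronger than required: one factor `min T d` is given up to `d`.
  have key : S * r * (d : ℝ) ^ (-(1 / 2) : ℝ) * ((min T d : ℕ) : ℝ) ^ 2 ≤
      S * r * √d * (min T d : ℕ) := by
    calc S * r * (d : ℝ) ^ (-(1 / 2) : ℝ) * ((min T d : ℕ) : ℝ) ^ 2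
        = S * r * (d : ℝ) ^ (-(1 / 2) : ℝ) * (min T d : ℕ) * (min T d : ℕ) := by ring
      _ ≤ S * r * (d : ℝ) ^ (-(1 / 2) : ℝ) * (min T d : ℕ) * d := by gcongr
      _ = S * r * ((d : ℝ) ^ (-(1 / 2) : ℝ) * d) * (min T d : ℕ) := by ring
      _ = _ := by rw [hpow]
  gcongr
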